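/- Let $T=\{1243,1342,2413\}$, and for $n\ge 0$ let $S_n(T)$ be the set of permutations of $\{1,\dots,n\}$ (in one-line notation) that avoid every pattern in $T$, i.e. that have no subsequence order-isomorphic to an element of $T$. Let $F_T(x)=\sum_{n\ge 0}|S_n(T)|\,x^n$ be the generating function. Then $$F_T(x)=\frac{(1-2x)\bigl(1-2x-\sqrt{1-8x+20x^2-20x^3+4x^4}\,\bigr)}{2x\,(1-4x+5x^2-x^3)}$$ as formal power series, where the square root denotes the formal power series with constant term $1$ whose square is $1-8x+20x^2-20x^3+4x^4$. -/

import Mathlib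

open PowerSeries LaurentSeries

namespace PatternAvoidance

/-- The permutation `σ` of `{0, …, n-1}` (in one-line notation `σ 0, σ 1, …, σ (n-1)`) contains the
pattern `τ`: some subsequence of `σ`, taken at the increasing positions `f 0 < … < f (k-1)`, is
order-isomorphic to `τ`. -/
def Contains {n k : ℕ} (σ : Equiv.Perm (Fin n)) (τ : Equiv.Perm (Fin k)) : Prop :=
  ∃ f : Fin k ↪o Fin n, ∀ i j : Fin k, σ (f i) < σ (f j) ↔ τ i < τ j

/-- `S_n(T)`: the permutations of length `n` that contain no pattern of `T`. -/
def avoiders {k : ℕ} (T : Set (Equiv.Perm (Fin k))) (n : ℕ) : Set (Equiv.Perm (Fin n)) :=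
  {σ | ∀ τ ∈ T, ¬ Contains σ τ}

/-- The formal power series `F_T(x) = ∑_{n ≥ 0} |S_n(T)| x ^ n`. -/
noncomputable def genFun {k : ℕ} (T : Set (Equiv.Perm (Fin k))) : ℚ⟦X⟧ :=
  PowerSeries.mk fun n => ((avoiders T n).ncard : ℚ)

/-- The pattern `1243`, with letters shifted down by one. -/
def p1243 : Equiv.Perm (Fin 4) where
  toFun := ![0, 1, 3, 2]
  invFun := ![0, 1, 3, 2]
  left_inv := by decide
  right_inv := by decide

/-- The pattern `1342`, with letters shifted down by one. -/
def p1342 : Equiv.Perm (Fin 4) where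
  toFun := ![0, 2, 3, 1]
  invFun := ![0, 3, 1, 2]
  left_inv := by decide
  right_inv := by decide

/-- The pattern `2413`, with letters shifted down by one. -/
def p2413 : Equiv.Perm (Fin 4) where
  toFun := ![1, 3, 0, 2]
  invFun := ![2, 0, 3, 1]
  left_inv := by decide
  right_inv := by decide

end PatternAvoidance

namespace PatternAvoidance

/-! Write an avoiding word on `[0, n + 1)` as `L n R`. Let `t` be one more than the largest letter
of `R` (0 if `R` is empty), and let `q` be the least letter of `L` if it lies below `t`, otherwise
`t`. An ascent in `L` starting below `t`, followed by `n` and `t - 1`, would be 1243 or 1342;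
letters `b`, `c` of `R` in this order with `b < a < c` for some `a` in `L` would make `a n b c` a
2413. Hence `L = A u` and `R = w D`, where `A` lists `[t, n)`, `D` lists `[0, q)`, and the core `(u,
w)` lists `[q, t)` with `u` decreasing. If the core is nonempty, `q` stands before `w`, so `w` has
no interior peak. Conversely, any avoiding `A`, `D` and any core reassemble to an avoiding word, so
F = 1 + x F² H with H the series of the cores (`exists_isDecomposition`,
`IsDecomposition.avoidsPatterns_assemble`, `genFun_eq`).

Cores are counted by removing the top letter, which can stand only at the head of `u` or at an end
of `w`. This gives (1 - 2x)² H = 1 - 4x + 5x² - x³ (`coreSeries_eq`), and solving the quadratic for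
F gives the formula. -/

/-! ### Permutations as words on intervals -/

/-- The word `l` has no subsequence order-isomorphic to `1243`, `1342` or `2413`. -/
def AvoidsPatterns (l : List ℕ) : Prop :=
  ∀ a b c d, [a, b, c, d].Sublist l →
    ¬(a < b ∧ b < d ∧ d < c) ∧ ¬(a < d ∧ d < b ∧ b < c) ∧ ¬(c < a ∧ a < d ∧ d < b)

/-- The word `l` lists every element of the interval `[q, t)` exactly once. -/
def ListsIco (q t : ℕ) (l : List ℕ) : Prop :=
  l.Nodup ∧ ∀ x, x ∈ l ↔ q ≤ x ∧ x < t

open Classical in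
/-- The pattern avoiding arrangements of the interval `[q, t)`. -/
noncomputable def words (q t : ℕ) : Finset (List ℕ) :=
  {l ∈ (List.range' q (t - q)).permutations.toFinset | AvoidsPatterns l}

theorem listsIco_iff_perm {q t : ℕ} {l : List ℕ} :
    ListsIco q t l ↔ l.Perm (List.range' q (t - q)) := by
  constructor
  · rintro ⟨h1, h2⟩
    rw [List.perm_ext_iff_of_nodup h1 List.nodup_range']
    intro x
    rw [h2, List.mem_range'_1]
    omega
  · intro h
    refine ⟨h.nodup_iff.2 List.nodup_range', fun x => ?_⟩
    rw [h.mem_iff, List.mem_range'_1]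
    omega

theorem mem_words {q t : ℕ} {l : List ℕ} :
    l ∈ words q t ↔ ListsIco q t l ∧ AvoidsPatterns l := by
  classical
  rw [words, Finset.mem_filter, List.mem_toFinset, List.mem_permutations, listsIco_iff_perm]

theorem ListsIco.length_eq {q t : ℕ} {l : List ℕ} (h : ListsIco q t l) : l.length = t - q := by
  rw [(listsIco_iff_perm.1 h).length_eq, List.length_range']

theorem AvoidsPatterns.sublist {l m : List ℕ} (h : AvoidsPatterns m) (hl : l.Sublist m) :
    AvoidsPatterns l :=
  fun a b c d hs => h a b c d (hs.trans hl)

/-- The one-line notation of `σ`, with all letters shifted up by `q`. -/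
def oneLine (q : ℕ) {n : ℕ} (σ : Equiv.Perm (Fin n)) : List ℕ :=
  List.ofFn fun i => q + (σ i : ℕ)

theorem oneLine_injective (q n : ℕ) :
    Function.Injective (oneLine q : Equiv.Perm (Fin n) → List ℕ) := by
  intro σ τ h
  have := List.ofFn_injective h
  ext i
  have : q + (σ i : ℕ) = q + (τ i : ℕ) := congrFun this i
  omega

theorem listsIco_oneLine (q : ℕ) {n : ℕ} (σ : Equiv.Perm (Fin n)) :
    ListsIco q (q + n) (oneLine q σ) := by
  constructor
  · rw [oneLine, List.nodup_ofFn]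
    intro i j h
    apply σ.injective
    ext
    exact Nat.add_left_cancel h
  · intro x
    rw [oneLine, List.mem_ofFn]
    constructor
    · rintro ⟨i, rfl⟩
      have := (σ i).2
      omega
    · rintro ⟨h1, h2⟩
      refine ⟨σ.symm ⟨x - q, by omega⟩, ?_⟩
      simp only [Equiv.apply_symm_apply]
      omega

theorem exists_oneLine_eq {q n : ℕ} {l : List ℕ} (h : ListsIco q (q + n) l) :
    ∃ σ : Equiv.Perm (Fin n), oneLine q σ = l := by
  have hlen : l.length = n := by rw [h.length_eq]; omega
  subst hlen
  have hm : ∀ i : Fin l.length, q ≤ l.get i ∧ l.get i < q + l.length :=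
    fun i => (h.2 _).1 (l.get_mem i)
  let f : Fin l.length → Fin l.length := fun i => ⟨l.get i - q, by have := hm i; omega⟩
  have hf : Function.Injective f := by
    intro i j hij
    have h1 := hm i
    have h2 := hm j
    have h3 : l.get i - q = l.get j - q := congrArg Fin.val hij
    exact (List.nodup_iff_injective_get.1 h.1) (by omega)
  refine ⟨Equiv.ofBijective f (Finite.injective_iff_bijective.1 hf), ?_⟩
  conv_rhs => rw [← List.ofFn_get l]
  rw [oneLine]
  congr 1
  funext i
  have := hm i
  change q + (l.get i - q) = _
  omega

theorem contains_iff_sublist (q : ℕ) {n : ℕ} (σ : Equiv.Perm (Fin n)) (τ : Equiv.Perm (Fin 4)) :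
    Contains σ τ ↔ ∃ a b c d, [a, b, c, d].Sublist (oneLine q σ) ∧
      ∀ i j, ![a, b, c, d] i < ![a, b, c, d] j ↔ τ i < τ j := by
  constructor
  · rintro ⟨f, hf⟩
    refine ⟨q + σ (f 0), q + σ (f 1), q + σ (f 2), q + σ (f 3), ?_, ?_⟩
    · rw [List.sublist_iff_exists_fin_orderEmbedding_get_eq]
      refine ⟨f.trans (Fin.castOrderIso (by simp [oneLine])).toOrderEmbedding, ?_⟩
      intro i
      fin_cases i <;> simp [oneLine] <;> rfl
    · intro i j
      rw [← hf i j]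
      fin_cases i <;> fin_cases j <;> simp
  · rintro ⟨a, b, c, d, hs, ho⟩
    rw [List.sublist_iff_exists_fin_orderEmbedding_get_eq] at hs
    obtain ⟨f, hf⟩ := hs
    let g : Fin 4 ↪o Fin n := RelEmbedding.trans f
      (Fin.castOrderIso (by simp [oneLine])).toOrderEmbedding
    have hg : ∀ i : Fin 4, ![a, b, c, d] i = q + σ (g i) := by
      intro i
      have := hf i
      have e : [a, b, c, d].get i = ![a, b, c, d] i := by fin_cases i <;> rfl
      rw [e] at this
      rw [this]
      simp [oneLine, g]
      rfl
    refine ⟨g, fun i j => ?_⟩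
    rw [← ho i j, hg, hg, Fin.lt_def]
    omega

theorem avoidsPatterns_oneLine (q : ℕ) {n : ℕ} (σ : Equiv.Perm (Fin n)) :
    AvoidsPatterns (oneLine q σ) ↔ σ ∈ avoiders {p1243, p1342, p2413} n := by
  have h1 : ∀ a b c d : ℕ, (∀ i j, ![a, b, c, d] i < ![a, b, c, d] j ↔ p1243 i < p1243 j) ↔
      (a < b ∧ b < d ∧ d < c) := by
    intro a b c d
    simp [Fin.forall_fin_succ, p1243]
    omega
  have h2 : ∀ a b c d : ℕ, (∀ i j, ![a, b, c, d] i < ![a, b, c, d] j ↔ p1342 i < p1342 j) ↔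
      (a < d ∧ d < b ∧ b < c) := by
    intro a b c d
    simp [Fin.forall_fin_succ, p1342]
    omega
  have h3 : ∀ a b c d : ℕ, (∀ i j, ![a, b, c, d] i < ![a, b, c, d] j ↔ p2413 i < p2413 j) ↔
      (c < a ∧ a < d ∧ d < b) := by
    intro a b c d
    simp [Fin.forall_fin_succ, p2413]
    omega
  simp only [avoiders, Set.mem_ofPred_eq, Set.mem_insert_iff, Set.mem_singleton_iff, forall_eq_or_imp,
    forall_eq, contains_iff_sublist q, h1, h2, h3, AvoidsPatterns, not_exists, not_and]
  grind

/-- The right-hand side is free of `q`: the number of avoiding arrangements depends only on the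
length of the interval. -/
theorem card_words (q n : ℕ) :
    (words q (q + n)).card = (avoiders {p1243, p1342, p2413} n).ncard := by
  rw [← Set.ncard_coe_finset, ← Set.ncard_image_of_injective _ (oneLine_injective q n)]
  congr 1
  ext l
  simp only [Finset.mem_coe, mem_words, Set.mem_image]
  constructor
  · rintro ⟨h1, h2⟩
    obtain ⟨σ, rfl⟩ := exists_oneLine_eq h1
    exact ⟨σ, (avoidsPatterns_oneLine q σ).1 h2, rfl⟩
  · rintro ⟨σ, h, rfl⟩
    exact ⟨listsIco_oneLine q σ, (avoidsPatterns_oneLine q σ).2 h⟩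

/-! ### Valleys -/

/-- A word in which no letter lies above letters on both of its sides. -/
def IsValley (w : List ℕ) : Prop :=
  ∀ a b c, [a, b, c].Sublist w → ¬(a < b ∧ c < b)

theorem IsValley.sublist {w w' : List ℕ} (h : IsValley w) (hs : w'.Sublist w) : IsValley w' :=
  fun a b c hs' => h a b c (hs'.trans hs)

theorem isValley_cons {t : ℕ} {w : List ℕ} (h : ∀ x ∈ w, x < t) :
    IsValley (t :: w) ↔ IsValley w := by
  refine ⟨fun h' => h'.sublist (List.sublist_cons_self t w), fun h' a b c hs => ?_⟩
  rcases List.sublist_cons_iff.1 hs with hs | ⟨r, hr, hs⟩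
  · exact h' a b c hs
  · obtain ⟨rfl, rfl⟩ := List.cons.inj hr
    have := h b (hs.subset (by simp))
    omega

theorem isValley_concat {t : ℕ} {w : List ℕ} (h : ∀ x ∈ w, x < t) :
    IsValley (w ++ [t]) ↔ IsValley w := by
  refine ⟨fun h' => h'.sublist (List.sublist_append_left w [t]), fun h' a b c hs => ?_⟩
  obtain ⟨l₁, l₂, he, h₁, h₂⟩ := List.sublist_append_iff.1 hs
  rcases List.sublist_singleton.1 h₂ with rfl | rfl
  · rw [List.append_nil] at he
    exact h' a b c (he ▸ h₁)
  · have e : [a, b] ++ [c] = l₁ ++ [t] := he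
    obtain ⟨h₃, e'⟩ := List.append_inj' e rfl
    subst h₃
    have := h b (h₁.subset (by simp))
    have := List.singleton_inj.1 e'
    omega

/-- Letters on both sides of the maximum would make it a peak. -/
theorem IsValley.eq_cons_or_eq_concat {t : ℕ} {w : List ℕ} (h : IsValley w) (hn : w.Nodup)
    (ht : t ∈ w) (hle : ∀ x ∈ w, x ≤ t) : ∃ w', w = t :: w' ∨ w = w' ++ [t] := by
  obtain ⟨s, r, rfl⟩ := List.append_of_mem ht
  rcases s with _ | ⟨x, s⟩
  · exact ⟨r, Or.inl rfl⟩
  rcases r with _ | ⟨y, r⟩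
  · exact ⟨_, Or.inr rfl⟩
  exfalso
  have hs : [x, t, y].Sublist (x :: s ++ t :: y :: r) := by
    refine List.Sublist.cons_cons x ?_
    exact List.sublist_append_of_sublist_right
      (List.Sublist.cons_cons t (List.Sublist.cons_cons y (List.nil_sublist r)))
  have h1 := h x t y hs
  have h2 := hle x (by simp)
  have h3 := hle y (by simp)
  have h4 : x ≠ t := by grind
  have h5 : y ≠ t := by grind
  omega

theorem ListsIco.congr_perm {q t : ℕ} {l m : List ℕ} (h : l.Perm m) :
    ListsIco q t l ↔ ListsIco q t m := by
  rw [listsIco_iff_perm, listsIco_iff_perm, h.congr_left]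

theorem listsIco_cons_top {q t : ℕ} {l : List ℕ} (h : q ≤ t) :
    ListsIco q (t + 1) (t :: l) ↔ ListsIco q t l := by
  simp only [ListsIco, List.nodup_cons, List.mem_cons]
  constructor
  · rintro ⟨⟨h1, h2⟩, h3⟩
    refine ⟨h2, fun x => ?_⟩
    have := h3 x
    by_cases hx : x = t
    · subst hx
      simp [h1]
    · rw [or_iff_right hx] at this
      rw [this]
      omega
  · rintro ⟨h1, h2⟩
    refine ⟨⟨by rw [h2]; omega, h1⟩, fun x => ?_⟩
    rw [h2]
    omega

theorem listsIco_append_cons_top {q t : ℕ} {u w : List ℕ} (h : q ≤ t) :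
    ListsIco q (t + 1) (u ++ t :: w) ↔ ListsIco q t (u ++ w) := by
  rw [ListsIco.congr_perm List.perm_middle, listsIco_cons_top h]

theorem listsIco_append_concat_top {q t : ℕ} {u w : List ℕ} (h : q ≤ t) :
    ListsIco q (t + 1) (u ++ (w ++ [t])) ↔ ListsIco q t (u ++ w) := by
  rw [← List.append_assoc, ListsIco.congr_perm (List.perm_append_singleton _ _),
    listsIco_cons_top h]

/-! ### Frames and cores, built by inserting the top letter -/

/-- Pairs `(u, w)` that together list `[q, t)`, with `u` decreasing and ending in `q`, such that
`w` is a valley; these are the conditions common to all the cores. -/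
structure IsFrame (q t : ℕ) (u w : List ℕ) : Prop where
  lists : ListsIco q t (u ++ w)
  mem : q ∈ u
  decreasing : u.Pairwise (· > ·)
  valley : IsValley w

/-- No letter of `u` separates two letters of `w` that stand in increasing order. -/
def Unsplit (u w : List ℕ) : Prop :=
  ∀ a ∈ u, w.Pairwise fun b c => ¬(b < a ∧ a < c)

/-- The frames on `[q, q + m + 1)` with `w` nonempty and above `u`. -/
def lowerFrames (q : ℕ) : ℕ → Finset (List ℕ × List ℕ)
  | 0 => ∅
  -- A one-letter `w` is listed apart: prepending and appending to the empty word would produce it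
  -- twice.
  | m + 1 => insert ((List.range' q (m + 1)).reverse, [q + m + 1])
      ((lowerFrames q m).image (fun p => (p.1, (q + m + 1) :: p.2)) ∪
        (lowerFrames q m).image (fun p => (p.1, p.2 ++ [q + m + 1])))

/-- The unsplit frames on `[q, q + m + 1)`. -/
def unsplitFrames (q : ℕ) : ℕ → Finset (List ℕ × List ℕ)
  | 0 => {([q], [])}
  | m + 1 => (unsplitFrames q m).image (fun p => ((q + m + 1) :: p.1, p.2)) ∪
      ((unsplitFrames q m).image (fun p => (p.1, (q + m + 1) :: p.2)) ∪
        (lowerFrames q m).image (fun p => (p.1, p.2 ++ [q + m + 1])))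

/-- The pairs `(u, w)` on `[q, q + m)` that are empty, or unsplit frames with top letter in `w`. -/
def cores (q : ℕ) : ℕ → Finset (List ℕ × List ℕ)
  | 0 => {([], [])}
  -- A single letter would be both the least, in `u`, and the largest, in `w`.
  | 1 => ∅
  | m + 2 => (unsplitFrames q m).image (fun p => (p.1, (q + m + 1) :: p.2)) ∪
        (lowerFrames q m).image (fun p => (p.1, p.2 ++ [q + m + 1]))

theorem IsFrame.lt {q t : ℕ} {u w : List ℕ} (h : IsFrame q t u w) {x : ℕ} (hx : x ∈ u ++ w) :
    x < t := ((h.lists.2 x).1 hx).2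

theorem IsFrame.le {q t : ℕ} {u w : List ℕ} (h : IsFrame q t u w) {x : ℕ} (hx : x ∈ u ++ w) :
    q ≤ x := ((h.lists.2 x).1 hx).1

theorem isFrame_cons_right {q t : ℕ} {u w : List ℕ} (hqt : q ≤ t) :
    IsFrame q (t + 1) u (t :: w) ↔ IsFrame q t u w := by
  constructor
  · rintro ⟨h1, h2, h3, h4⟩
    exact ⟨(listsIco_append_cons_top hqt).1 h1, h2, h3, h4.sublist (List.sublist_cons_self t w)⟩
  · intro h
    exact ⟨(listsIco_append_cons_top hqt).2 h.lists, h.mem, h.decreasing,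
      (isValley_cons fun x hx => h.lt (by simp [hx])).2 h.valley⟩

theorem isFrame_concat_right {q t : ℕ} {u w : List ℕ} (hqt : q ≤ t) :
    IsFrame q (t + 1) u (w ++ [t]) ↔ IsFrame q t u w := by
  constructor
  · rintro ⟨h1, h2, h3, h4⟩
    exact ⟨(listsIco_append_concat_top hqt).1 h1, h2, h3,
      h4.sublist (List.sublist_append_left w [t])⟩
  · intro h
    exact ⟨(listsIco_append_concat_top hqt).2 h.lists, h.mem, h.decreasing,
      (isValley_concat fun x hx => h.lt (by simp [hx])).2 h.valley⟩

theorem isFrame_cons_left {q t : ℕ} {u w : List ℕ} (hqt : q < t) :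
    IsFrame q (t + 1) (t :: u) w ↔ IsFrame q t u w := by
  constructor
  · rintro ⟨h1, h2, h3, h4⟩
    exact ⟨(listsIco_cons_top hqt.le).1 h1, (List.mem_cons.1 h2).resolve_left hqt.ne,
      h3.of_cons, h4⟩
  · intro h
    exact ⟨(listsIco_cons_top hqt.le).2 h.lists, List.mem_cons_of_mem _ h.mem,
      List.pairwise_cons.2 ⟨fun x hx => h.lt (by simp [hx]), h.decreasing⟩, h.valley⟩

theorem IsFrame.top_mem_right {q t : ℕ} {u w : List ℕ} (h : IsFrame q (t + 1) u w) (ht : t ∈ w) :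
    ∃ w', w = t :: w' ∨ w = w' ++ [t] :=
  h.valley.eq_cons_or_eq_concat h.lists.1.of_append_right ht
    fun x hx => Nat.le_of_lt_succ (h.lt (by simp [hx]))

theorem IsFrame.top_mem_left {q t : ℕ} {u w : List ℕ} (h : IsFrame q (t + 1) u w) (ht : t ∈ u) :
    ∃ u', u = t :: u' := by
  rcases u with _ | ⟨x, u⟩
  · simp at ht
  · rcases List.mem_cons.1 ht with rfl | ht
    · exact ⟨u, rfl⟩
    · have h1 := (List.pairwise_cons.1 h.decreasing).1 t ht
      have h2 := h.lt (x := x) (by simp)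
      omega

theorem IsFrame.top_mem {q t : ℕ} {u w : List ℕ} (h : IsFrame q (t + 1) u w) :
    t ∈ u ∨ t ∈ w := by
  have h1 := h.le (List.mem_append_left _ h.mem)
  have h2 := h.lt (List.mem_append_left _ h.mem)
  exact List.mem_append.1 ((h.lists.2 t).2 ⟨by omega, by omega⟩)

theorem isFrame_nil_iff {q m : ℕ} {u : List ℕ} :
    IsFrame q (q + (m + 1)) u [] ↔ u = (List.range' q (m + 1)).reverse := by
  constructor
  · rintro ⟨h1, -, h3, -⟩
    rw [List.append_nil, listsIco_iff_perm, Nat.add_sub_cancel_left] at h1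
    exact (h1.trans (List.reverse_perm _).symm).eq_of_pairwise
      (fun a b _ _ h h' => absurd h (Nat.lt_asymm h')) h3
        (List.pairwise_reverse.2 List.pairwise_lt_range')
  · rintro rfl
    refine ⟨?_, ?_, List.pairwise_reverse.2 List.pairwise_lt_range', fun a b c h => ?_⟩
    · rw [List.append_nil, listsIco_iff_perm, Nat.add_sub_cancel_left]
      exact List.reverse_perm _
    · simp
    · simp at h

/-- Since `w` is nonempty and above `u`, the top letter lies in `w`, at one of its ends; removing it
leaves a smaller frame of the same kind or an empty `w`. -/
theorem mem_lowerFrames {q m : ℕ} {u w : List ℕ} : (u, w) ∈ lowerFrames q m ↔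
    IsFrame q (q + m + 1) u w ∧ w ≠ [] ∧ ∀ a ∈ u, ∀ b ∈ w, a < b := by
  induction m generalizing u w with
  | zero =>
    refine iff_of_false (by simp [lowerFrames]) ?_
    rintro ⟨h1, h2, h3⟩
    obtain ⟨b, hb⟩ := List.exists_mem_of_ne_nil w h2
    have := h3 q h1.mem b hb
    have := h1.lt (x := b) (by simp [hb])
    omega
  | succ m ih =>
    simp only [lowerFrames, Finset.mem_insert, Finset.mem_union, Finset.mem_image, Prod.exists,
      Prod.mk.injEq, ih]
    constructor
    · rintro (⟨rfl, rfl⟩ | ⟨u, w, ⟨h1, h2, h3⟩, rfl, rfl⟩ | ⟨u, w, ⟨h1, h2, h3⟩, rfl, rfl⟩)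
      · refine ⟨(isFrame_cons_right (by omega)).2 (isFrame_nil_iff.2 rfl), by simp, ?_⟩
        intro a ha b hb
        simp at ha hb
        omega
      · refine ⟨(isFrame_cons_right (by omega)).2 h1, by simp, ?_⟩
        intro a ha b hb
        rcases List.mem_cons.1 hb with rfl | hb
        · exact h1.lt (by simp [ha])
        · exact h3 a ha b hb
      · refine ⟨(isFrame_concat_right (by omega)).2 h1, by simp, ?_⟩
        intro a ha b hb
        rcases List.mem_append.1 hb with hb | hb
        · exact h3 a ha b hb
        · rw [List.mem_singleton.1 hb]
          exact h1.lt (by simp [ha])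
    · rintro ⟨h1, h2, h3⟩
      have ht : q + m + 1 ∈ w := by
        rcases h1.top_mem with ht | ht
        · obtain ⟨b, hb⟩ := List.exists_mem_of_ne_nil w h2
          have := h3 _ ht b hb
          have := h1.lt (x := b) (by simp [hb])
          omega
        · exact ht
      obtain ⟨w', rfl | rfl⟩ := h1.top_mem_right ht
      · have h1' := (isFrame_cons_right (by omega)).1 h1
        by_cases hw : w' = []
        · subst hw
          exact Or.inl ⟨isFrame_nil_iff.1 h1', rfl⟩
        · exact Or.inr (Or.inl ⟨u, w', ⟨h1', hw, fun a ha b hb => h3 a ha b (by simp [hb])⟩,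
            rfl, rfl⟩)
      · have h1' := (isFrame_concat_right (by omega)).1 h1
        by_cases hw : w' = []
        · subst hw
          exact Or.inl ⟨isFrame_nil_iff.1 h1', rfl⟩
        · exact Or.inr (Or.inr ⟨u, w', ⟨h1', hw, fun a ha b hb => h3 a ha b (by simp [hb])⟩,
            rfl, rfl⟩)

theorem IsFrame.unsplit_cons_right {q t : ℕ} {u w : List ℕ} (h : IsFrame q t u w) :
    Unsplit u (t :: w) ↔ Unsplit u w := by
  refine forall₂_congr fun a ha => ?_
  rw [List.pairwise_cons, and_iff_right]
  intro b _
  have := h.lt (x := a) (by simp [ha])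
  omega

theorem IsFrame.unsplit_cons_left {q t : ℕ} {u w : List ℕ} (h : IsFrame q t u w) :
    Unsplit (t :: u) w ↔ Unsplit u w := by
  rw [Unsplit, List.forall_mem_cons, ← Unsplit, and_iff_right]
  refine List.Pairwise.imp_of_mem (R := fun _ _ => True) ?_ (List.pairwise_of_forall (by simp))
  intro b c _ hc _
  have := h.lt (x := c) (by simp [hc])
  omega

/-- A final top letter forms an increasing pair with every letter `b` of `w`, and this pair is split
by any `a` in `u` above `b`. At the head of `u` or `w` the top letter splits nothing and starts no
increasing pair. -/
theorem IsFrame.unsplit_concat_right {q t : ℕ} {u w : List ℕ} (h : IsFrame q t u w) :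
    Unsplit u (w ++ [t]) ↔ ∀ a ∈ u, ∀ b ∈ w, a < b := by
  refine forall₂_congr fun a ha => ?_
  rw [List.pairwise_append]
  have hat := h.lt (x := a) (by simp [ha])
  constructor
  · rintro ⟨-, -, h3⟩ b hb
    have := h3 b hb t (by simp)
    have hne : a ≠ b := by
      rintro rfl
      exact (List.disjoint_of_nodup_append h.lists.1) ha hb
    omega
  · intro h3
    refine ⟨?_, by simp, fun b hb c _ => by have := h3 b hb; omega⟩
    refine List.Pairwise.imp_of_mem (R := fun _ _ => True) ?_ (List.pairwise_of_forall (by simp))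
    intro b c hb _ _
    have := h3 b hb
    omega

/-- Unsplit frames whose second word contains the top letter `t`. -/
theorem unsplit_frame_top_mem_iff {q m : ℕ} {u w : List ℕ}
    (hK : ∀ {u w}, (u, w) ∈ unsplitFrames q m ↔ IsFrame q (q + m + 1) u w ∧ Unsplit u w) :
    (u, w) ∈ (unsplitFrames q m).image (fun p => (p.1, (q + m + 1) :: p.2)) ∪
        (lowerFrames q m).image (fun p => (p.1, p.2 ++ [q + m + 1])) ↔
      IsFrame q (q + m + 1 + 1) u w ∧ Unsplit u w ∧ q + m + 1 ∈ w := by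
  simp only [Finset.mem_union, Finset.mem_image, Prod.exists, Prod.mk.injEq, hK, mem_lowerFrames]
  constructor
  · rintro (⟨u, w, ⟨h1, h2⟩, rfl, rfl⟩ | ⟨u, w, ⟨h1, h2, h3⟩, rfl, rfl⟩)
    · exact ⟨(isFrame_cons_right (by omega)).2 h1, h1.unsplit_cons_right.2 h2, by simp⟩
    · exact ⟨(isFrame_concat_right (by omega)).2 h1, h1.unsplit_concat_right.2 h3, by simp⟩
  · rintro ⟨h1, h2, h3⟩
    obtain ⟨w', rfl | rfl⟩ := h1.top_mem_right h3
    · have h1' := (isFrame_cons_right (by omega)).1 h1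
      exact Or.inl ⟨u, w', ⟨h1', h1'.unsplit_cons_right.1 h2⟩, rfl, rfl⟩
    · have h1' := (isFrame_concat_right (by omega)).1 h1
      by_cases hw : w' = []
      · subst hw
        exact Or.inl ⟨u, [], ⟨h1', fun a _ => List.Pairwise.nil⟩, rfl, rfl⟩
      · exact Or.inr ⟨u, w', ⟨h1', hw, h1'.unsplit_concat_right.1 h2⟩, rfl, rfl⟩

theorem mem_unsplitFrames {q m : ℕ} {u w : List ℕ} : (u, w) ∈ unsplitFrames q m ↔
    IsFrame q (q + m + 1) u w ∧ Unsplit u w := by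
  induction m generalizing u w with
  | zero =>
    simp only [unsplitFrames, Finset.mem_singleton, Prod.mk.injEq]
    constructor
    · rintro ⟨rfl, rfl⟩
      exact ⟨isFrame_nil_iff.2 rfl, fun a _ => List.Pairwise.nil⟩
    · rintro ⟨h1, -⟩
      have hw : w = [] := by
        rw [List.eq_nil_iff_forall_not_mem]
        intro x hx
        have := h1.lt (x := x) (by simp [hx])
        have := h1.le (x := x) (by simp [hx])
        obtain rfl : x = q := by omega
        exact List.disjoint_of_nodup_append h1.lists.1 h1.mem hx
      subst hw
      exact ⟨isFrame_nil_iff.1 h1, rfl⟩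
  | succ m ih =>
    rw [unsplitFrames, Finset.mem_union, unsplit_frame_top_mem_iff ih]
    simp only [Finset.mem_image, Prod.exists, Prod.mk.injEq, ih]
    constructor
    · rintro (⟨u, w, ⟨h1, h2⟩, rfl, rfl⟩ | ⟨h1, h2, -⟩)
      · exact ⟨(isFrame_cons_left (by omega)).2 h1, h1.unsplit_cons_left.2 h2⟩
      · exact ⟨h1, h2⟩
    · rintro ⟨h1, h2⟩
      rcases h1.top_mem with ht | ht
      · obtain ⟨u', rfl⟩ := h1.top_mem_left ht
        have h1' := (isFrame_cons_left (by omega)).1 h1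
        exact Or.inl ⟨u', w, ⟨h1', h1'.unsplit_cons_left.1 h2⟩, rfl, rfl⟩
      · exact Or.inr ⟨h1, h2, ht⟩

theorem mem_cores {q m : ℕ} {u w : List ℕ} : (u, w) ∈ cores q m ↔
    (m = 0 ∧ u = [] ∧ w = []) ∨
      (IsFrame q (q + m) u w ∧ Unsplit u w ∧ 0 < m ∧ q + m - 1 ∈ w) := by
  rcases m with _ | _ | m
  · simp [cores]
  · simp only [cores, Finset.notMem_empty, false_iff]
    rintro (⟨h, -⟩ | ⟨h1, -, -, h2⟩)
    · omega
    · exact List.disjoint_of_nodup_append h1.lists.1 h1.mem h2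
  · rw [cores, unsplit_frame_top_mem_iff mem_unsplitFrames]
    simp [add_assoc]

/-! ### Counting cores -/

theorem card_image_cons_union_image_concat {S T : Finset (List ℕ × List ℕ)} {t : ℕ}
    (hT : ∀ p ∈ T, p.2 ≠ [] ∧ t ∉ p.2) :
    (S.image (fun p => (p.1, t :: p.2)) ∪ T.image (fun p => (p.1, p.2 ++ [t]))).card =
      S.card + T.card := by
  rw [Finset.card_union_of_disjoint, Finset.card_image_of_injective, Finset.card_image_of_injective]
  · rintro ⟨a, b⟩ ⟨c, d⟩ h
    simpa using h
  · rintro ⟨a, b⟩ ⟨c, d⟩ h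
    simpa using h
  · rw [Finset.disjoint_left]
    simp only [Finset.mem_image, Prod.exists, not_exists, not_and]
    rintro _ ⟨u, w, -, rfl⟩ u' w' h' he
    obtain ⟨h1, h2⟩ := hT _ h'
    rcases w' with _ | ⟨x, w'⟩
    · exact h1 rfl
    · obtain ⟨-, he⟩ := Prod.mk.inj he
      obtain ⟨rfl, -⟩ := List.cons.inj he
      simp at h2

theorem ne_nil_and_notMem_of_mem_lowerFrames {q m : ℕ} (p : List ℕ × List ℕ)
    (hp : p ∈ lowerFrames q m) : p.2 ≠ [] ∧ q + m + 1 ∉ p.2 := by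
  obtain ⟨h1, h2, -⟩ := mem_lowerFrames.1 hp
  exact ⟨h2, fun h => (h1.lt (List.mem_append_right _ h)).false⟩

theorem card_lowerFrames_succ (q m : ℕ) :
    (lowerFrames q (m + 1)).card = 2 * (lowerFrames q m).card + 1 := by
  rw [lowerFrames, Finset.card_insert_of_notMem,
    card_image_cons_union_image_concat ne_nil_and_notMem_of_mem_lowerFrames, two_mul]
  simp only [Finset.mem_union, Finset.mem_image, Prod.exists, Prod.mk.injEq, not_or, not_exists,
    not_and]
  constructor
  · rintro u w h rfl h'
    exact (ne_nil_and_notMem_of_mem_lowerFrames _ h).1 (List.cons.inj h').2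
  · rintro u w h rfl h'
    exact (ne_nil_and_notMem_of_mem_lowerFrames _ h).1 (by simpa using h')

theorem card_unsplitFrames_succ (q m : ℕ) : (unsplitFrames q (m + 1)).card =
    2 * (unsplitFrames q m).card + (lowerFrames q m).card := by
  rw [unsplitFrames, Finset.card_union_of_disjoint,
    card_image_cons_union_image_concat ne_nil_and_notMem_of_mem_lowerFrames,
    Finset.card_image_of_injective]
  · ring
  · rintro ⟨a, b⟩ ⟨c, d⟩ h
    simpa using h
  · rw [Finset.disjoint_left]
    simp only [Finset.mem_image, Finset.mem_union, Prod.exists]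
    rintro _ ⟨u, w, -, rfl⟩ (⟨u', w', h, he⟩ | ⟨u', w', h, he⟩) <;>
    obtain ⟨rfl, -⟩ := Prod.mk.inj he
    · exact ((mem_unsplitFrames.1 h).1.lt (by simp)).false
    · exact ((mem_lowerFrames.1 h).1.lt (by simp)).false

theorem card_cores_add_two (q m : ℕ) : (cores q (m + 2)).card =
    (unsplitFrames q m).card + (lowerFrames q m).card := by
  rw [cores, card_image_cons_union_image_concat ne_nil_and_notMem_of_mem_lowerFrames]

theorem card_lowerFrames_eq (q m : ℕ) : (lowerFrames q m).card = (lowerFrames 0 m).card := by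
  induction m with
  | zero => rfl
  | succ m ih => rw [card_lowerFrames_succ, card_lowerFrames_succ, ih]

theorem card_unsplitFrames_eq (q m : ℕ) :
    (unsplitFrames q m).card = (unsplitFrames 0 m).card := by
  induction m with
  | zero => rfl
  | succ m ih =>
    rw [card_unsplitFrames_succ, card_unsplitFrames_succ, ih, card_lowerFrames_eq]

theorem card_cores_eq (q m : ℕ) : (cores q m).card = (cores 0 m).card := by
  rcases m with _ | _ | m
  · rfl
  · rfl
  · rw [card_cores_add_two, card_cores_add_two, card_unsplitFrames_eq, card_lowerFrames_eq]

/-- The generating function of the cores. -/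
noncomputable def coreSeries : ℚ⟦X⟧ := PowerSeries.mk fun m => ((cores 0 m).card : ℚ)

/-- The recursions give 2^m - 1 lower frames and m 2^(m-1) + 1 unsplit frames. The constants cancel
in the sum (m + 2) 2^(m-1), which leaves the double characteristic root 2. -/
theorem card_cores_add_four (m : ℕ) :
    (cores 0 (m + 4)).card + 4 * (cores 0 (m + 2)).card = 4 * (cores 0 (m + 3)).card := by
  have h1 := card_cores_add_two 0 m
  have h2 := card_cores_add_two 0 (m + 1)
  have h3 := card_cores_add_two 0 (m + 2)
  have h4 := card_unsplitFrames_succ 0 m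
  have h5 := card_unsplitFrames_succ 0 (m + 1)
  have h6 := card_lowerFrames_succ 0 m
  have h7 := card_lowerFrames_succ 0 (m + 1)
  simp only [add_assoc, Nat.reduceAdd] at *
  omega

/-- The recurrence kills all coefficients from degree 4 on; the counts 1, 0, 1, 3 give the rest. -/
theorem coreSeries_eq :
    (1 - 2 * X) ^ 2 * coreSeries = 1 - 4 * X + 5 * X ^ 2 - X ^ 3 := by
  have c0 : (cores 0 0).card = 1 := rfl
  have c1 : (cores 0 1).card = 0 := rfl
  have c2 : (cores 0 2).card = 1 := rfl
  have c3 : (cores 0 3).card = 3 := by decide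
  have e : (1 - 2 * X) ^ 2 * coreSeries =
      coreSeries - PowerSeries.C 4 * (X * coreSeries) + PowerSeries.C 4 * (X ^ 2 * coreSeries) := by
    rw [map_ofNat]
    ring
  have e' : (1 - 4 * X + 5 * X ^ 2 - X ^ 3 : ℚ⟦X⟧) =
      1 - PowerSeries.C 4 * X + PowerSeries.C 5 * X ^ 2 - X ^ 3 := by
    rw [map_ofNat, map_ofNat]
  rw [e, e']
  ext n
  simp only [map_sub, map_add, coeff_C_mul, coeff_X_pow, coeff_one, coeff_X, coreSeries]
  rcases n with _ | _ | _ | _ | n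
  · simp [c0, coeff_X_pow_mul']
  · simp [c0, c1, coeff_X_pow_mul', coeff_succ_X_mul]
  · simp [c0, c1, c2, coeff_X_pow_mul', coeff_succ_X_mul]
    norm_num
  · simp [c1, c2, c3, coeff_X_pow_mul', coeff_succ_X_mul]
    norm_num
  · have h := card_cores_add_four n
    have h' : ((cores 0 (n + 4)).card + 4 * (cores 0 (n + 2)).card : ℚ) =
        4 * (cores 0 (n + 3)).card := by exact_mod_cast h
    simp [coeff_X_pow_mul', coeff_succ_X_mul]
    linarith

/-! ### Assembling words, and uniqueness of the data -/

/-- The word with first part `A ++ u`, top letter `n` and second part `w ++ D`. -/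
def assemble (n : ℕ) (p : List ℕ × List ℕ × List ℕ × List ℕ) : List ℕ :=
  (p.1 ++ p.2.2.1) ++ n :: (p.2.2.2 ++ p.2.1)

/-- The data from which the avoiding words on `[0, n + 1)` are assembled: avoiding words `A` on
`[t, n)` and `D` on `[0, q)` and a core `(u, w)` on `[q, t)`. -/
structure IsDecomposition (n q t : ℕ) (A D u w : List ℕ) : Prop where
  le : q ≤ t
  le_top : t ≤ n
  upper : A ∈ words t n
  lower : D ∈ words 0 q
  core : (u, w) ∈ cores q (t - q)

theorem listsIco_self {q : ℕ} {l : List ℕ} : ListsIco q q l ↔ l = [] := by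
  rw [listsIco_iff_perm, Nat.sub_self, List.range'_zero, List.perm_nil]

namespace IsDecomposition

variable {n q t : ℕ} {A D u w : List ℕ}

theorem core_cases (h : IsDecomposition n q t A D u w) : (q = t ∧ u = [] ∧ w = []) ∨
    (IsFrame q t u w ∧ Unsplit u w ∧ q < t ∧ t - 1 ∈ w) := by
  have h1 := h.le
  have := mem_cores.1 h.core
  rw [Nat.add_sub_cancel' h1] at this
  refine this.imp (fun h => ⟨by omega, h.2⟩) (fun h => ⟨h.1, h.2.1, by omega, h.2.2.2⟩)

theorem lists_core (h : IsDecomposition n q t A D u w) : ListsIco q t (u ++ w) := by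
  rcases h.core_cases with ⟨rfl, rfl, rfl⟩ | ⟨h, -⟩
  · exact listsIco_self.2 rfl
  · exact h.lists

theorem mem_left {x : ℕ} (h : IsDecomposition n q t A D u w) (hx : x ∈ A ++ u) :
    q ≤ x ∧ x < n := by
  have h1 := h.le
  have h2 := h.le_top
  rcases List.mem_append.1 hx with hx | hx
  · have := ((mem_words.1 h.upper).1.2 x).1 hx
    omega
  · have := (h.lists_core.2 x).1 (by simp [hx])
    omega

theorem mem_right {x : ℕ} (h : IsDecomposition n q t A D u w) (hx : x ∈ w ++ D) : x < t := by
  have h1 := h.le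
  rcases List.mem_append.1 hx with hx | hx
  · have := (h.lists_core.2 x).1 (by simp [hx])
    omega
  · have := ((mem_words.1 h.lower).1.2 x).1 hx
    omega

theorem pred_mem_right (h : IsDecomposition n q t A D u w) (ht : 0 < t) : t - 1 ∈ w ++ D := by
  rcases h.core_cases with ⟨rfl, -, -⟩ | ⟨-, -, -, h⟩
  · exact List.mem_append_right _ (((mem_words.1 h.lower).1.2 _).2 ⟨by omega, by omega⟩)
  · exact List.mem_append_left _ h

theorem mem_left_of_lt (h : IsDecomposition n q t A D u w) (ht : q < t) : q ∈ A ++ u := by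
  rcases h.core_cases with ⟨rfl, -, -⟩ | ⟨h, -, -, -⟩
  · omega
  · exact List.mem_append_right _ h.mem

variable {q' t' : ℕ} {A' D' u' w' : List ℕ}

theorem le_of_right_eq (h : IsDecomposition n q t A D u w)
    (h' : IsDecomposition n q' t' A' D' u' w') (e : w ++ D = w' ++ D') : t ≤ t' := by
  rcases Nat.eq_zero_or_pos t with h0 | h0
  · omega
  · have h1 := h.pred_mem_right h0
    have h2 := h'.mem_right (e ▸ h1)
    omega

theorem le_of_left_eq (h : IsDecomposition n q t A D u w)
    (h' : IsDecomposition n q' t A' D' u' w') (e : A ++ u = A' ++ u') : q' ≤ q := by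
  rcases h.le.eq_or_lt with h0 | h0
  · rw [h0]
    exact h'.le
  · exact (h'.mem_left (e ▸ h.mem_left_of_lt h0)).1

/-- The word determines its parts on either side of `n`. The right part determines `t`, as its
strict upper bound; the left part and `t` then determine `q`. Lengths locate the remaining cuts. -/
theorem eq_of_assemble_eq (h : IsDecomposition n q t A D u w)
    (h' : IsDecomposition n q' t' A' D' u' w')
    (e : assemble n (A, D, u, w) = assemble n (A', D', u', w')) :
    (A, D, u, w) = (A', D', u', w') := by
  have hn : n ∉ A ++ u := fun hx => (h.mem_left hx).2.false
  have hn' : n ∉ w ++ D := fun hx => ((h.mem_right hx).trans_le h.le_top).false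
  obtain ⟨e1, -, e2⟩ := (List.append_cons_inj_of_notMem hn hn').1 e
  obtain rfl : t = t' := (h.le_of_right_eq h' e2).antisymm (h'.le_of_right_eq h e2.symm)
  obtain rfl : q = q' := (h'.le_of_left_eq h e1.symm).antisymm (h.le_of_left_eq h' e1)
  obtain ⟨rfl, rfl⟩ := List.append_inj e1
    (by rw [(mem_words.1 h.upper).1.length_eq, (mem_words.1 h'.upper).1.length_eq])
  obtain ⟨rfl, rfl⟩ := List.append_inj' e2
    (by rw [(mem_words.1 h.lower).1.length_eq, (mem_words.1 h'.lower).1.length_eq])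
  rfl

theorem listsIco_assemble (h : IsDecomposition n q t A D u w) :
    ListsIco 0 (n + 1) (assemble n (A, D, u, w)) := by
  have hp : (assemble n (A, D, u, w)).Perm (n :: (D ++ ((u ++ w) ++ A))) := by
    rw [List.perm_iff_count]
    intro a
    simp only [assemble, List.count_append, List.count_cons]
    omega
  have hA := (mem_words.1 h.upper).1
  have hD := (mem_words.1 h.lower).1
  have hU := h.lists_core
  have h1 := h.le
  have h2 := h.le_top
  rw [ListsIco.congr_perm hp, listsIco_cons_top (Nat.zero_le n)]
  constructor
  · rw [List.nodup_append', List.nodup_append' (l₂ := A)]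
    refine ⟨hD.1, ⟨hU.1, hA.1, fun x hx hx' => ?_⟩, fun x hx hx' => ?_⟩
    · have := (hU.2 x).1 hx
      have := (hA.2 x).1 hx'
      omega
    · have := (hD.2 x).1 hx
      rw [List.mem_append, hU.2, hA.2] at hx'
      omega
  · intro x
    rw [List.mem_append, List.mem_append, hD.2, hU.2, hA.2]
    omega

end IsDecomposition

/-! ### Assembled words avoid the patterns -/

theorem append_eq_four {a b c d : ℕ} {l₁ l₂ : List ℕ} (h : [a, b, c, d] = l₁ ++ l₂) :
    (l₁ = [] ∧ l₂ = [a, b, c, d]) ∨ (l₁ = [a] ∧ l₂ = [b, c, d]) ∨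
    (l₁ = [a, b] ∧ l₂ = [c, d]) ∨ (l₁ = [a, b, c] ∧ l₂ = [d]) ∨
    (l₁ = [a, b, c, d] ∧ l₂ = []) := by
  rcases l₁ with _ | ⟨x, _ | ⟨y, _ | ⟨z, _ | ⟨v, l₁⟩⟩⟩⟩ <;> simp_all

/-- The three patterns are skew indecomposable. -/
theorem AvoidsPatterns.skew_append {l m : List ℕ} (hl : AvoidsPatterns l) (hm : AvoidsPatterns m)
    (h : ∀ x ∈ l, ∀ y ∈ m, y < x) : AvoidsPatterns (l ++ m) := by
  intro a b c d hs
  obtain ⟨l₁, l₂, e, h₁, h₂⟩ := List.sublist_append_iff.1 hs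
  have hlt : ∀ x ∈ l₁, ∀ y ∈ l₂, y < x := fun x hx y hy => h x (h₁.subset hx) y (h₂.subset hy)
  rcases append_eq_four e with ⟨rfl, rfl⟩ | ⟨rfl, rfl⟩ | ⟨rfl, rfl⟩ | ⟨rfl, rfl⟩ | ⟨rfl, rfl⟩
  · exact hm a b c d h₂
  · simp only [List.mem_cons, List.not_mem_nil, or_false, forall_eq_or_imp, forall_eq] at hlt
    omega
  · simp only [List.mem_cons, List.not_mem_nil, or_false, forall_eq_or_imp, forall_eq] at hlt
    omega
  · simp only [List.mem_cons, List.not_mem_nil, or_false, forall_eq_or_imp, forall_eq] at hlt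
    omega
  · exact hl a b c d h₁

/-- A word whose letters lie below `n` but above a word `m`, apart from the letter `n` of `m`, can
be put in front of `m`. -/
theorem AvoidsPatterns.append_of_top {n : ℕ} {l m : List ℕ} (hl : AvoidsPatterns l)
    (hm : AvoidsPatterns m) (hln : ∀ x ∈ l, x < n)
    (h : ∀ x ∈ l, ∀ y ∈ m, y = n ∨ y < x) : AvoidsPatterns (l ++ m) := by
  intro a b c d hs
  obtain ⟨l₁, l₂, e, h₁, h₂⟩ := List.sublist_append_iff.1 hs
  have hlt : ∀ x ∈ l₁, ∀ y ∈ l₂, y = n ∨ y < x :=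
    fun x hx y hy => h x (h₁.subset hx) y (h₂.subset hy)
  have hln' : ∀ x ∈ l₁, x < n := fun x hx => hln x (h₁.subset hx)
  -- However one of the patterns is cut, some letter after the cut that is not its maximum exceeds a
  -- letter before the cut. Here only `n` could do so, and `n` could only play the maximum.
  rcases append_eq_four e with ⟨rfl, rfl⟩ | ⟨rfl, rfl⟩ | ⟨rfl, rfl⟩ | ⟨rfl, rfl⟩ | ⟨rfl, rfl⟩
  · exact hm a b c d h₂
  · simp only [List.mem_cons, List.not_mem_nil, or_false, forall_eq_or_imp, forall_eq] at hlt hln'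
    omega
  · simp only [List.mem_cons, List.not_mem_nil, or_false, forall_eq_or_imp, forall_eq] at hlt hln'
    omega
  · simp only [List.mem_cons, List.not_mem_nil, or_false, forall_eq_or_imp, forall_eq] at hlt hln'
    omega
  · exact hl a b c d h₁

theorem IsValley.avoidsPatterns {w : List ℕ} (h : IsValley w) : AvoidsPatterns w := by
  intro a b c d hs
  have h1 := h b c d ((List.sublist_cons_self _ _).trans hs)
  have h2 := h a b c (List.Sublist.trans (by simp) hs)
  omega

/-- All three patterns start with an ascent, so at most one letter comes from the decreasing `u`.
The last three letters of 1243 and 1342 have a peak, impossible in the valley `n :: w`; for 2413 the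
letters 1 and 3 lie in `w` and are split by the 2. -/
theorem avoidsPatterns_core {n : ℕ} {u w : List ℕ} (hu : u.Pairwise (· > ·)) (hw : IsValley w)
    (hs : Unsplit u w) (hn : ∀ x ∈ w, x < n) : AvoidsPatterns (u ++ n :: w) := by
  have hv : IsValley (n :: w) := (isValley_cons hn).2 hw
  intro a b c d h
  obtain ⟨l₁, l₂, e, h₁, h₂⟩ := List.sublist_append_iff.1 h
  rcases append_eq_four e with ⟨rfl, rfl⟩ | ⟨rfl, rfl⟩ | ⟨rfl, rfl⟩ | ⟨rfl, rfl⟩ | ⟨rfl, rfl⟩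
  · exact hv.avoidsPatterns a b c d h₂
  · have h3 := hv b c d h₂
    have h4 := List.pairwise_iff_forall_sublist.1 (hs a (h₁.subset (by simp))) h₂.of_cons_cons
    omega
  · have := List.pairwise_iff_forall_sublist.1 hu h₁
    omega
  · have := List.pairwise_iff_forall_sublist.1 hu (List.Sublist.trans (by simp) h₁ : [a, b].Sublist u)
    omega
  · have := List.pairwise_iff_forall_sublist.1 hu (List.Sublist.trans (by simp) h₁ : [a, b].Sublist u)
    omega

theorem IsDecomposition.avoidsPatterns_assemble {n q t : ℕ} {A D u w : List ℕ}
    (h : IsDecomposition n q t A D u w) : AvoidsPatterns (assemble n (A, D, u, w)) := by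
  have hA := mem_words.1 h.upper
  have hD := mem_words.1 h.lower
  have hU := h.lists_core
  have h1 := h.le
  have h2 := h.le_top
  have hcore : AvoidsPatterns (u ++ n :: w) := by
    rcases h.core_cases with ⟨rfl, rfl, rfl⟩ | ⟨h3, h4, -, -⟩
    · exact avoidsPatterns_core List.Pairwise.nil (fun a b c h => by simp at h) (by simp [Unsplit])
        (by simp)
    · refine avoidsPatterns_core h3.decreasing h3.valley h4 fun x hx => ?_
      have := h3.lt (x := x) (by simp [hx])
      omega
  have e : assemble n (A, D, u, w) = (A ++ (u ++ n :: w)) ++ D := by simp [assemble]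
  rw [e]
  have hmem : ∀ y ∈ u ++ n :: w, y = n ∨ (q ≤ y ∧ y < t) := by
    intro y hy
    rwa [List.perm_middle.mem_iff, List.mem_cons, hU.2] at hy
  refine AvoidsPatterns.skew_append (hA.2.append_of_top hcore
    (fun x hx => ((hA.1.2 x).1 hx).2) fun x hx y hy => ?_) hD.2 fun x hx y hy => ?_
  · have := (hA.1.2 x).1 hx
    have := hmem y hy
    omega
  · have := (hD.1.2 y).1 hy
    rcases List.mem_append.1 hx with hx | hx
    · have := (hA.1.2 x).1 hx
      omega
    · have := hmem x hx
      omega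

/-! ### Every avoiding word decomposes -/

theorem eq_filter_append_filter {t : ℕ} {l : List ℕ}
    (h : l.Pairwise fun a b => ¬(a < t ∧ t ≤ b)) :
    l = l.filter (t ≤ ·) ++ l.filter (· < t) := by
  induction l with
  | nil => rfl
  | cons x l ih =>
    rw [List.pairwise_cons] at h
    by_cases hx : t ≤ x
    · simpa [List.filter_cons, hx, Nat.not_lt.2 hx] using ih h.2
    · have h1 : l.filter (t ≤ ·) = [] := by
        rw [List.filter_eq_nil_iff]
        intro y hy
        have := h.1 y hy
        simp only [decide_eq_true_eq]
        omega
      have h2 := ih h.2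
      rw [h1, List.nil_append] at h2
      simp [hx, h1, Nat.not_le.1 hx, ← h2]

theorem exists_strict_upper_bound (l : List ℕ) :
    ∃ t, (∀ x ∈ l, x < t) ∧ (t = 0 ∨ t - 1 ∈ l) := by
  induction l with
  | nil => exact ⟨0, by simp⟩
  | cons y l ih =>
    obtain ⟨t, h1, h2⟩ := ih
    rcases le_total t (y + 1) with h | h
    · refine ⟨y + 1, ?_, Or.inr (by simp)⟩
      simp only [List.forall_mem_cons]
      exact ⟨by omega, fun x hx => (h1 x hx).trans_le h⟩
    · exact ⟨t, by simpa using ⟨by omega, h1⟩, h2.imp_right (List.mem_cons_of_mem _)⟩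

theorem exists_lower_bound (l : List ℕ) (t : ℕ) :
    ∃ q ≤ t, (∀ x ∈ l, q ≤ x) ∧ (q = t ∨ q ∈ l) := by
  induction l with
  | nil => exact ⟨t, le_rfl, by simp⟩
  | cons y l ih =>
    obtain ⟨q, h0, h1, h2⟩ := ih
    rcases le_total q y with h | h
    · exact ⟨q, h0, by simpa using ⟨by omega, h1⟩, h2.imp_right (List.mem_cons_of_mem _)⟩
    · refine ⟨y, h.trans h0, ?_, Or.inr (by simp)⟩
      simp only [List.forall_mem_cons]
      exact ⟨by omega, fun x hx => h.trans (h1 x hx)⟩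

theorem exists_isDecomposition {n : ℕ} {l : List ℕ} (h : l ∈ words 0 (n + 1)) :
    ∃ q t A D u w, IsDecomposition n q t A D u w ∧ assemble n (A, D, u, w) = l := by
  obtain ⟨⟨hnd, hmem⟩, hav⟩ := mem_words.1 h
  obtain ⟨L, R, rfl⟩ := List.append_of_mem ((hmem n).2 ⟨by omega, by omega⟩)
  obtain ⟨t, ht, ht'⟩ := exists_strict_upper_bound R
  obtain ⟨q, hqt, hq, hq'⟩ := exists_lower_bound L t
  have hnd' := hnd
  rw [List.perm_middle.nodup_iff, List.nodup_cons, List.nodup_append', List.mem_append] at hnd'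
  obtain ⟨hnm, hL, hR, hLR⟩ := hnd'
  have hmem' : ∀ x, (x ∈ L ∨ x ∈ R) ↔ x < n := by
    intro x
    have := hmem x
    rw [List.perm_middle.mem_iff, List.mem_cons, List.mem_append] at this
    by_cases hx : x = n
    · subst hx
      simpa using hnm
    · rw [or_iff_right hx] at this
      rw [this]
      omega
  have htn : t ≤ n := by
    rcases ht' with h0 | h0
    · omega
    · have := (hmem' _).1 (Or.inr h0)
      omega
  have hdis : ∀ {x y}, x ∈ L → y ∈ R → x ≠ y := fun hx hy e => hLR hx (e ▸ hy)
  -- If `a < b` with `a < t`, then `a b n (t - 1)` is 1243 or 1342, according to whether `b` is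
  -- below or above `t - 1`.
  have hdec : L.Pairwise fun a b => a < t → b < a := by
    rw [List.pairwise_iff_forall_sublist]
    intro a b hab hat
    by_contra hba
    have hr : t - 1 ∈ R := ht'.resolve_left (by omega)
    have haL : a ∈ L := hab.subset (by simp)
    have hbL : b ∈ L := hab.subset (by simp)
    have hne : a ≠ b := by
      have := hL.sublist hab
      simpa using this
    have h1 := hdis haL hr
    have h2 := hdis hbL hr
    have h3 := (hmem' b).1 (Or.inl hbL)
    have h4 := hav a b n (t - 1) (hab.append
      (List.Sublist.cons_cons n (List.singleton_sublist.2 hr)))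
    omega
  -- Otherwise `a n b c` is a 2413.
  have hsplit : ∀ a ∈ L, R.Pairwise fun b c => ¬(b < a ∧ a < c) := by
    intro a ha
    rw [List.pairwise_iff_forall_sublist]
    intro b c hbc
    have h1 := (hmem' c).1 (Or.inr (hbc.subset (by simp)))
    have h2 := hav a n b c ((List.singleton_sublist.2 ha).append (List.Sublist.cons_cons n hbc))
    omega
  have eL : L = L.filter (t ≤ ·) ++ L.filter (· < t) :=
    eq_filter_append_filter (hdec.imp fun hab => by omega)
  -- If `q = t`, all of `R` lies below `q`; otherwise `q` is a letter of `L`, and `hsplit` at `q`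
  -- applies.
  have eR : R = R.filter (q ≤ ·) ++ R.filter (· < q) := by
    refine eq_filter_append_filter ?_
    rcases hq' with rfl | hqL
    · refine List.Pairwise.imp_of_mem (R := fun _ _ => True) ?_ (List.pairwise_of_forall (by simp))
      intro a b _ hb _
      have := ht b hb
      omega
    · refine (hsplit q hqL).imp_of_mem ?_
      intro a b _ hb hab
      have := hdis hqL hb
      omega
  have hcore : ListsIco q t (L.filter (· < t) ++ R.filter (q ≤ ·)) := by
    constructor
    · rw [List.nodup_append']
      exact ⟨hL.filter _, hR.filter _, fun x hx hx' =>
        hLR (List.mem_filter.1 hx).1 (List.mem_filter.1 hx').1⟩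
    · intro x
      simp only [List.mem_append, List.mem_filter, decide_eq_true_eq]
      have h1 := hmem' x
      constructor
      · rintro (⟨h2, h3⟩ | ⟨h2, h3⟩)
        · exact ⟨hq x h2, h3⟩
        · exact ⟨h3, ht x h2⟩
      · rintro ⟨h2, h3⟩
        rcases h1.2 (by omega) with h4 | h4
        · exact Or.inl ⟨h4, h3⟩
        · exact Or.inr ⟨h4, h2⟩
  refine ⟨q, t, L.filter (t ≤ ·), R.filter (· < q), L.filter (· < t), R.filter (q ≤ ·),
    ⟨hqt, htn, mem_words.2 ⟨⟨hL.filter _, fun x => ?_⟩, hav.sublist ?_⟩,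
      mem_words.2 ⟨⟨hR.filter _, fun x => ?_⟩, hav.sublist ?_⟩, ?_⟩, ?_⟩
  · rw [List.mem_filter, decide_eq_true_eq]
    constructor
    · rintro ⟨h1, h2⟩
      exact ⟨h2, (hmem' x).1 (Or.inl h1)⟩
    · rintro ⟨h1, h2⟩
      refine ⟨((hmem' x).2 h2).resolve_right fun h3 => ?_, h1⟩
      have := ht x h3
      omega
  · exact List.filter_sublist.trans (List.sublist_append_left _ _)
  · rw [List.mem_filter, decide_eq_true_eq]
    constructor
    · rintro ⟨h1, h2⟩
      exact ⟨Nat.zero_le x, h2⟩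
    · rintro ⟨-, h2⟩
      refine ⟨((hmem' x).2 (by omega)).resolve_left fun h3 => ?_, h2⟩
      have := hq x h3
      omega
  · exact List.filter_sublist.trans
      ((List.sublist_cons_self _ _).trans (List.sublist_append_right _ _))
  · rw [mem_cores, Nat.add_sub_cancel' hqt]
    rcases hqt.eq_or_lt with rfl | hlt
    · left
      have := listsIco_self.1 hcore
      exact ⟨Nat.sub_self q, List.append_eq_nil_iff.1 this⟩
    · right
      have hqL := hq'.resolve_left hlt.ne
      have hr : t - 1 ∈ R := ht'.resolve_left (by omega)
      refine ⟨⟨hcore, by simp [hqL, hlt], ?_, ?_⟩, ?_, by omega, ?_⟩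
      · rw [List.pairwise_filter]
        exact hdec.imp fun hab h1 _ => hab (by simpa using h1)
      -- A peak `b c d` in `w` would form 1243 or 1342 with the smaller letter `q` before it.
      · intro b c d hs
        have hbig : ∀ x ∈ [b, c, d], q < x := by
          intro x hx
          obtain ⟨h1, h2⟩ := List.mem_filter.1 (hs.subset hx)
          have := hdis hqL h1
          simp only [decide_eq_true_eq] at h2
          omega
        have hs' : [b, c, d].Sublist R := hs.trans List.filter_sublist
        have hne : b ≠ d := by
          have := hR.sublist hs'
          simp only [List.nodup_cons, List.mem_cons] at this
          tauto
        have h1 := hbig b (by simp)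
        have h2 := hbig d (by simp)
        have h3 := hav q b c d ((List.singleton_sublist.2 hqL).append
          (hs'.trans (List.sublist_cons_self n R)))
        omega
      · intro a ha
        exact (hsplit a (List.mem_filter.1 ha).1).sublist List.filter_sublist
      · rw [List.mem_filter, decide_eq_true_eq]
        exact ⟨hr, by omega⟩
  · rw [assemble, ← eL, ← eR]

/-! ### Functional equation -/

/-- All the data for assembling avoiding words on `[0, n + 1)`. -/
noncomputable def decompositions (n : ℕ) : Finset (List ℕ × List ℕ × List ℕ × List ℕ) :=
  -- Here `x.2` is the size of the core, and `y` holds the lengths of `A` and `D`; so `q = y.2` and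
  -- `t = y.2 + x.2`.
  (Finset.HasAntidiagonal.antidiagonal n).biUnion fun x => (Finset.HasAntidiagonal.antidiagonal x.1).biUnion fun y =>
    words (y.2 + x.2) (y.2 + x.2 + y.1) ×ˢ words 0 y.2 ×ˢ cores y.2 x.2

theorem mem_decompositions {n : ℕ} {A D u w : List ℕ} :
    (A, D, u, w) ∈ decompositions n ↔ ∃ q t, IsDecomposition n q t A D u w := by
  simp only [decompositions, Finset.mem_biUnion, Finset.HasAntidiagonal.mem_antidiagonal, Finset.mem_product,
    Prod.exists]
  constructor
  · rintro ⟨s, m, rfl, p, q, rfl, h1, h2, h3⟩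
    refine ⟨q, q + m, by omega, by omega, ?_, h2, by simpa using h3⟩
    convert h1 using 2
    omega
  · rintro ⟨q, t, h⟩
    have h1 := h.le
    have h2 := h.le_top
    refine ⟨n - t + q, t - q, by omega, n - t, q, rfl, ?_, h.lower, h.core⟩
    convert h.upper using 2 <;> omega

theorem card_decompositions (n : ℕ) : (decompositions n).card =
    ∑ x ∈ Finset.HasAntidiagonal.antidiagonal n, (∑ y ∈ Finset.HasAntidiagonal.antidiagonal x.1,
      (words 0 y.1).card * (words 0 y.2).card) * (cores 0 x.2).card := by
  rw [decompositions, Finset.card_biUnion]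
  · refine Finset.sum_congr rfl fun x _ => ?_
    rw [Finset.card_biUnion, Finset.sum_mul]
    · refine Finset.sum_congr rfl fun y _ => ?_
      have h1 := card_words 0 y.1
      rw [Nat.zero_add] at h1
      rw [Finset.card_product, Finset.card_product, card_words, ← h1, card_cores_eq, mul_assoc]
    · rintro ⟨p, q⟩ _ ⟨p', q'⟩ _ hne
      rw [Function.onFun, Finset.disjoint_left]
      rintro ⟨A, D, c⟩ h1 h2
      simp only [Finset.mem_product, mem_words] at h1 h2
      have e1 := h1.1.1.length_eq.symm.trans h2.1.1.length_eq
      have e2 := h1.2.1.1.length_eq.symm.trans h2.2.1.1.length_eq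
      apply hne
      ext <;> simp only <;> omega
  · rintro ⟨s, m⟩ hs ⟨s', m'⟩ hs' hne
    simp only [Finset.mem_coe, Finset.HasAntidiagonal.mem_antidiagonal] at hs hs'
    rw [Function.onFun, Finset.disjoint_left]
    rintro ⟨A, D, c⟩ h1 h2
    simp only [Finset.mem_biUnion, Finset.mem_product, mem_words, Finset.HasAntidiagonal.mem_antidiagonal,
      Prod.exists] at h1 h2
    obtain ⟨p, q, e, h1⟩ := h1
    obtain ⟨p', q', e', h2⟩ := h2
    have e1 := h1.1.1.length_eq.symm.trans h2.1.1.length_eq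
    have e2 := h1.2.1.1.length_eq.symm.trans h2.2.1.1.length_eq
    apply hne
    ext <;> simp only <;> omega

theorem card_words_succ (n : ℕ) : (words 0 (n + 1)).card = (decompositions n).card := by
  symm
  refine Finset.card_nbij (assemble n) ?_ ?_ ?_
  · rintro ⟨A, D, u, w⟩ h
    obtain ⟨q, t, h⟩ := mem_decompositions.1 h
    exact mem_words.2 ⟨h.listsIco_assemble, h.avoidsPatterns_assemble⟩
  · rintro ⟨A, D, u, w⟩ h ⟨A', D', u', w'⟩ h' e
    obtain ⟨q, t, h⟩ := mem_decompositions.1 h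
    obtain ⟨q', t', h'⟩ := mem_decompositions.1 h'
    exact h.eq_of_assemble_eq h' e
  · intro l hl
    obtain ⟨q, t, A, D, u, w, h, e⟩ := exists_isDecomposition hl
    exact ⟨_, mem_decompositions.2 ⟨q, t, h⟩, e⟩

/-- The factor `X` accounts for the largest letter, the two copies of the series for `A` and `D`,
and `coreSeries` for `(u, w)`. -/
theorem genFun_eq : genFun {p1243, p1342, p2413} =
    1 + X * (genFun {p1243, p1342, p2413} * genFun {p1243, p1342, p2413} * coreSeries) := by
  have hc : ∀ n, (avoiders {p1243, p1342, p2413} n).ncard = (words 0 n).card := by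
    intro n
    rw [← card_words 0 n, Nat.zero_add]
  simp only [genFun, hc, coreSeries]
  ext n
  rcases n with _ | n
  · have h0 : words 0 0 = {[]} := by
      ext l
      rw [mem_words, listsIco_self, Finset.mem_singleton, and_iff_left_iff_imp]
      rintro rfl a b c d h
      simp at h
    simp [h0]
  · rw [map_add, coeff_succ_X_mul, coeff_mul, coeff_mk, card_words_succ, card_decompositions]
    simp [coeff_mul, coeff_one]

/-! ### Solving the quadratic equation -/

/-- A power series `F = 1 + x F² H` with `(1 - 2x)² H = 1 - 4x + 5x² - x³` has the closed form
with a square root. -/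
theorem exists_sqrt_of_quadratic {F H : ℚ⟦X⟧} (hF : F = 1 + X * (F * F * H))
    (hH : (1 - 2 * X) ^ 2 * H = 1 - 4 * X + 5 * X ^ 2 - X ^ 3) :
    ∃ R : ℚ⟦X⟧, PowerSeries.constantCoeff R = 1 ∧
      R ^ 2 = 1 - 8 * (X : ℚ⟦X⟧) + 20 * X ^ 2 - 20 * X ^ 3 + 4 * X ^ 4 ∧
      (F : ℚ⸨X⸩) = (((1 - 2 * X) * (1 - 2 * X - R) : ℚ⟦X⟧) : ℚ⸨X⸩) /
          ((2 * X * (1 - 4 * X + 5 * X ^ 2 - X ^ 3) : ℚ⟦X⟧) : ℚ⸨X⸩) := by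
  obtain ⟨J, hJ⟩ : ∃ J : ℚ⟦X⟧, (1 - 2 * X) * J = 1 :=
    ⟨(1 - 2 * X)⁻¹, PowerSeries.mul_inv_cancel _ (by simp)⟩
  -- The claimed formula solved for the root, with `J` the inverse of `1 - 2 * X`: this is `(1 -
  -- 2x)(1 - 2xHF)`, and `(1 - 2xHF)² = 1 - 4xH` by the quadratic equation.
  refine ⟨1 - 2 * X - 2 * X * (1 - 4 * X + 5 * X ^ 2 - X ^ 3) * (F * J), by simp, ?_, ?_⟩
  · have h1 : (1 - 2 * X) * (F * J) - X * (1 - 4 * X + 5 * X ^ 2 - X ^ 3) * (F * J) ^ 2 = 1 := by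
      rw [← hH]
      linear_combination (F - X * F ^ 2 * H * (1 + (1 - 2 * X) * J)) * hJ + hF
    linear_combination (-4 * X * (1 - 4 * X + 5 * X ^ 2 - X ^ 3)) * h1
  · rw [eq_div_iff]
    · rw [← map_mul (HahnSeries.ofPowerSeries ℤ ℚ)]
      congr 1
      linear_combination (-2 * X * (1 - 4 * X + 5 * X ^ 2 - X ^ 3) * F) * hJ
    -- The denominator is nonzero because its cubic factor has constant term 1.
    · intro h
      have h0 : (2 * X * (1 - 4 * X + 5 * X ^ 2 - X ^ 3) : ℚ⟦X⟧) = 0 :=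
        HahnSeries.ofPowerSeries_injective (by rw [h, map_zero])
      have h2 := congrArg PowerSeries.constantCoeff ((mul_eq_zero.1 h0).resolve_left
        (mul_ne_zero (fun h2 => by simpa [map_ofNat] using congrArg PowerSeries.constantCoeff h2) X_ne_zero))
      simp at h2

end PatternAvoidance

/-- `R` is the formal square root of `1 - 8x + 20x² - 20x³ + 4x⁴` with constant term `1` (there is
only one, as the other root is `-R`); the quotient is taken in the field of formal Laurent series,
where its denominator is nonzero. -/
theorem mainTheorem10 :
    ∃ R : ℚ⟦X⟧,
      PowerSeries.constantCoeff R = 1 ∧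
      R ^ 2 = 1 - 8 * (X : ℚ⟦X⟧) + 20 * X ^ 2 - 20 * X ^ 3 + 4 * X ^ 4 ∧
      ((PatternAvoidance.genFun {PatternAvoidance.p1243, PatternAvoidance.p1342,
          PatternAvoidance.p2413} : ℚ⟦X⟧) : ℚ⸨X⸩) =
        (((1 - 2 * X) * (1 - 2 * X - R) : ℚ⟦X⟧) : ℚ⸨X⸩) /
          ((2 * X * (1 - 4 * X + 5 * X ^ 2 - X ^ 3) : ℚ⟦X⟧) : ℚ⸨X⸩) := by
  exact PatternAvoidance.exists_sqrt_of_quadratic PatternAvoidance.genFun_eq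
    PatternAvoidance.coreSeries_eq
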